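/- **Setting.** Let $n,d\in\mathbb{N}$ and let $H\le S_d$ act on $\mathbb{R}^d$ by $(h\cdot x)_j=x_{h^{-1}(j)}$. Let $G=S_n\times H$ act on $\mathbb{R}^{n\times d}$ by $((q,h)\cdot X)_{ij}=X_{q^{-1}(i)\,h^{-1}(j)}$; write $x_i\in\mathbb{R}^d$ for the $i$-th row of $X$. Both actions extend to several feature channels (to $\mathbb{R}^{d\times c}$ and $\mathbb{R}^{n\times d\times c}$) by acting in the same way on every channel. **Networks.** Let $\sigma:\mathbb{R}\to\mathbb{R}$ be a continuous activation function, applied pointwise. A multilayer perceptron (MLP) is a map $A_k\circ\sigma\circ A_{k-1}\circ\dots\circ\sigma\circ A_1$ with affine $A_i$ and arbitrary widths and depth. For a permutation group $\Gamma\le S_\ell$, a $\Gamma$-invariant network is a function $\mathbb{R}^\ell\to\mathbb{R}$ of the form $$m\circ\sigma\circ h\circ\sigma\circ L_k\circ\sigma\circ L_{k-1}\circ\dots\circ\sigma\circ L_1 ,\qquad k\ge 1,$$ where the $L_i:\mathbb{R}^{\ell\times c_i}\to\mathbb{R}^{\ell\times c_{i+1}}$ ($c_1=1$, the other numbers of channels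 arbitrary) are linear $\Gamma$-equivariant maps plus a $\Gamma$-fixed bias, $h:\mathbb{R}^{\ell\times c_{k+1}}\to\mathbb{R}^{c}$ is a linear $\Gamma$-invariant map plus a bias, and $m:\mathbb{R}^c\to\mathbb{R}$ is an MLP. A $G$-invariant DSS network is such a network on $\mathbb{R}^{n\times d}$ whose equivariant layers have the form $$L(X)_i=L_1^H(x_i)+L_2^H\Big(\sum_{k\ne i}x_k\Big)+v,$$ with $L_1^H,L_2^H$ linear and $H$-equivariant and $v$ an $H$-fixed bias, and whose invariant layer has the form $h(X)=L^H(\sum_k x_k)+w$ with $L^H$ linear and $H$-invariant and $w$ a bias. **Universality.** $H$-invariant networks are called universal if for every compact $K'\subset\mathbb{R}^d$ with $K'=\bigcup_{h\in H}hK'$, every continuous $H$-invariant $\varphi:K'\to\mathbb{R}$ and every $\varepsilon>0$ there is an $H$-invariant network $N$ with $|N(x)-\varphi(x)|<\varepsilon$ for all $x\in K'$. **Theorem.** Assume that MLPs with activation $\sigma$ are universal, that is, for every $m$ they uniformly approximate every continuous real-valued function on every compact subset of $\mathbb{R}^m$, and that $H$-invariant networks with activation $\sigma$ are universal. Let $$\mathcal{E}=\bigcup_{1\le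 k<j\le d}\Big\{X\in\mathbb{R}^{n\times d}:\ \sum_{i=1}^n X_{ik}=\sum_{i=1}^n X_{ij}\Big\},$$ and let $K\subset\mathbb{R}^{n\times d}$ be a compact set with $K=\bigcup_{g\in G}gK$ and $K\cap\mathcal{E}=\emptyset$. Then for every continuous $G$-invariant function $f:K\to\mathbb{R}$ and every $\varepsilon>0$ there is a $G$-invariant DSS network $N$ with activation $\sigma$ such that $|N(X)-f(X)|<\varepsilon$ for all $X\in K$. -/

import Mathlib

/-- The action of a permutation on a family indexed by `ι`: `(g · x) i = x (g⁻¹ i)`.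
With `α = ℝ` this is the action on `ℝ^ℓ`, with `α = Fin c → ℝ` the action on `ℝ^{ℓ × c}`
(`c` feature channels, all permuted in the same way). -/
def permAct {ι α : Type} (g : Equiv.Perm ι) (x : ι → α) : ι → α := fun i => x (g⁻¹ i)

/-- Pointwise application of the activation function to a vector of features. -/
def act {c : ℕ} (σ : ℝ → ℝ) (y : Fin c → ℝ) : Fin c → ℝ := fun k => σ (y k)

/-- Multilayer perceptrons (fully connected networks) with activation `σ`:
`A_k ∘ σ ∘ A_{k-1} ∘ ⋯ ∘ σ ∘ A_1` with arbitrary affine maps `A_i`, arbitrary widths and depth. -/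
inductive IsMLP (σ : ℝ → ℝ) : ∀ {a b : ℕ}, ((Fin a → ℝ) → (Fin b → ℝ)) → Prop
  | affine {a b : ℕ} (A : (Fin a → ℝ) →ₗ[ℝ] (Fin b → ℝ)) (v : Fin b → ℝ) :
      IsMLP σ (fun x => A x + v)
  | comp {a b c : ℕ} {N : (Fin a → ℝ) → (Fin b → ℝ)} (hN : IsMLP σ N)
      (A : (Fin b → ℝ) →ₗ[ℝ] (Fin c → ℝ)) (v : Fin c → ℝ) :
      IsMLP σ (fun x => A (act σ (N x)) + v)

/-- The universal approximation property of fully connected networks with activation `σ`. -/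
def MLPUniversal (σ : ℝ → ℝ) : Prop :=
  ∀ (m : ℕ) (K : Set (Fin m → ℝ)), IsCompact K →
    ∀ f : (Fin m → ℝ) → ℝ, ContinuousOn f K →
      ∀ ε : ℝ, 0 < ε →
        ∃ N : (Fin m → ℝ) → (Fin 1 → ℝ), IsMLP σ N ∧ ∀ x ∈ K, |N x 0 - f x| < ε

/-- Linear (with bias) `Γ`-equivariant layers `ℝ^{ℓ × a} → ℝ^{ℓ × b}`. -/
def IsEquivariantLayer {ι : Type} (Γ : Subgroup (Equiv.Perm ι)) {a b : ℕ}
    (L : (ι → Fin a → ℝ) → (ι → Fin b → ℝ)) : Prop :=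
  ∃ (A : (ι → Fin a → ℝ) →ₗ[ℝ] (ι → Fin b → ℝ)) (v : ι → Fin b → ℝ),
    (∀ g ∈ Γ, ∀ x, A (permAct g x) = permAct g (A x)) ∧
    (∀ g ∈ Γ, permAct g v = v) ∧
    ∀ x, L x = A x + v

/-- Linear (with bias) `Γ`-invariant layers `ℝ^{ℓ × a} → ℝ^b`. -/
def IsInvariantLayer {ι : Type} (Γ : Subgroup (Equiv.Perm ι)) {a b : ℕ}
    (h : (ι → Fin a → ℝ) → (Fin b → ℝ)) : Prop :=
  ∃ (A : (ι → Fin a → ℝ) →ₗ[ℝ] (Fin b → ℝ)) (v : Fin b → ℝ),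
    (∀ g ∈ Γ, ∀ x, A (permAct g x) = A x) ∧
    ∀ x, h x = A x + v

/-- Networks `L_k ∘ σ ∘ L_{k-1} ∘ ⋯ ∘ σ ∘ L_1` (`k ≥ 1`) whose layers `L_i` belong to a given
class of maps `ℝ^{ℓ × c_i} → ℝ^{ℓ × c_{i+1}}`; numbers of channels and depth are arbitrary. -/
inductive IsLayeredNet {ι : Type} (σ : ℝ → ℝ)
    (layer : ∀ a b : ℕ, ((ι → Fin a → ℝ) → (ι → Fin b → ℝ)) → Prop) :
    ∀ {a b : ℕ}, ((ι → Fin a → ℝ) → (ι → Fin b → ℝ)) → Prop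
  | single {a b : ℕ} {L : (ι → Fin a → ℝ) → (ι → Fin b → ℝ)} (hL : layer a b L) :
      IsLayeredNet σ layer L
  | comp {a b c : ℕ} {F : (ι → Fin a → ℝ) → (ι → Fin b → ℝ)}
      {L : (ι → Fin b → ℝ) → (ι → Fin c → ℝ)} (hF : IsLayeredNet σ layer F) (hL : layer b c L) :
      IsLayeredNet σ layer (fun x => L (fun i => act σ (F x i)))

/-- Real-valued networks `m ∘ σ ∘ h ∘ σ ∘ F` on `ℝ^ℓ` (one input channel), where `F` is a layered
network with layers in the class `layer`, `h` is in the class `pool`, and `m` is an MLP. -/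
def IsPooledNet {ι : Type} (σ : ℝ → ℝ)
    (layer : ∀ a b : ℕ, ((ι → Fin a → ℝ) → (ι → Fin b → ℝ)) → Prop)
    (pool : ∀ a b : ℕ, ((ι → Fin a → ℝ) → (Fin b → ℝ)) → Prop)
    (N : (ι → ℝ) → ℝ) : Prop :=
  ∃ (c₁ c₂ : ℕ) (F : (ι → Fin 1 → ℝ) → (ι → Fin c₁ → ℝ))
    (h : (ι → Fin c₁ → ℝ) → (Fin c₂ → ℝ)) (m : (Fin c₂ → ℝ) → (Fin 1 → ℝ)),
    IsLayeredNet σ layer F ∧ pool c₁ c₂ h ∧ IsMLP σ m ∧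
    ∀ x, N x = m (act σ (h (fun i => act σ (F (fun j _ => x j) i)))) 0

/-- `Γ`-invariant networks. -/
def IsInvariantNetwork {ι : Type} (σ : ℝ → ℝ) (Γ : Subgroup (Equiv.Perm ι))
    (N : (ι → ℝ) → ℝ) : Prop :=
  IsPooledNet σ (fun _ _ => IsEquivariantLayer Γ) (fun _ _ => IsInvariantLayer Γ) N

/-- `K = ⋃_{g ∈ Γ} g K`. -/
def IsStable {ι : Type} (Γ : Subgroup (Equiv.Perm ι)) (K : Set (ι → ℝ)) : Prop :=
  K = ⋃ g ∈ Γ, permAct g '' K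

/-- `f` is a `Γ`-invariant function on `K`. -/
def IsInvariantOn {ι : Type} (Γ : Subgroup (Equiv.Perm ι)) (K : Set (ι → ℝ))
    (f : (ι → ℝ) → ℝ) : Prop :=
  ∀ g ∈ Γ, ∀ x ∈ K, f (permAct g x) = f x

/-- `Γ`-invariant networks with activation `σ` are universal: on every compact `Γ`-stable set they
uniformly approximate every continuous `Γ`-invariant function. -/
def InvariantNetworksUniversal {ι : Type} (σ : ℝ → ℝ) (Γ : Subgroup (Equiv.Perm ι)) : Prop :=
  ∀ K : Set (ι → ℝ), IsCompact K → IsStable Γ K →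
    ∀ f : (ι → ℝ) → ℝ, ContinuousOn f K → IsInvariantOn Γ K f →
      ∀ ε : ℝ, 0 < ε → ∃ N : (ι → ℝ) → ℝ, IsInvariantNetwork σ Γ N ∧ ∀ x ∈ K, |N x - f x| < ε

/-- The group `G = S_n × H` acting on the entries of `n × d` matrices: rows are permuted by `S_n`
and all rows are acted on by the same element of `H`. -/
def setSymmetryGroup (n : ℕ) {d : ℕ} (H : Subgroup (Equiv.Perm (Fin d))) :
    Subgroup (Equiv.Perm (Fin n × Fin d)) where
  carrier := {g | ∃ q : Equiv.Perm (Fin n), ∃ h ∈ H, g = Equiv.prodCongr q h}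
  one_mem' := ⟨1, 1, H.one_mem, rfl⟩
  mul_mem' := by
    rintro _ _ ⟨q, h, hh, rfl⟩ ⟨q', h', hh', rfl⟩
    exact ⟨q * q', h * h', H.mul_mem hh hh', rfl⟩
  inv_mem' := by
    rintro _ ⟨q, h, hh, rfl⟩
    exact ⟨q⁻¹, h⁻¹, H.inv_mem hh, rfl⟩

/-- The `i`-th element `x_i ∈ ℝ^d` (or `ℝ^{d × c}`) of `X`. -/
def elt {n d : ℕ} {α : Type} (X : Fin n × Fin d → α) (i : Fin n) : Fin d → α :=
  fun j => X (i, j)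

/-- DSS layers `L(X)_i = L₁(x_i) + L₂(∑_{k ≠ i} x_k) + v`, with `L₁, L₂` linear and
`H`-equivariant, and with an `H`-fixed bias `v` shared by all the elements. -/
def IsDSSLayer {n d : ℕ} (H : Subgroup (Equiv.Perm (Fin d))) {a b : ℕ}
    (L : (Fin n × Fin d → Fin a → ℝ) → (Fin n × Fin d → Fin b → ℝ)) : Prop :=
  ∃ (L₁ L₂ : (Fin d → Fin a → ℝ) →ₗ[ℝ] (Fin d → Fin b → ℝ)) (v : Fin d → Fin b → ℝ),
    (∀ h ∈ H, ∀ x, L₁ (permAct h x) = permAct h (L₁ x)) ∧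
    (∀ h ∈ H, ∀ x, L₂ (permAct h x) = permAct h (L₂ x)) ∧
    (∀ h ∈ H, permAct h v = v) ∧
    ∀ X i, elt (L X) i = L₁ (elt X i) + L₂ (∑ k ∈ Finset.univ.erase i, elt X k) + v

/-- Invariant DSS layers `L(X) = L₀(∑_k x_k) + v`, with `L₀` linear and `H`-invariant. -/
def IsDSSInvariantLayer {n d : ℕ} (H : Subgroup (Equiv.Perm (Fin d))) {a b : ℕ}
    (L : (Fin n × Fin d → Fin a → ℝ) → (Fin b → ℝ)) : Prop :=
  ∃ (L₀ : (Fin d → Fin a → ℝ) →ₗ[ℝ] (Fin b → ℝ)) (v : Fin b → ℝ),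
    (∀ h ∈ H, ∀ x, L₀ (permAct h x) = L₀ x) ∧
    ∀ X, L X = L₀ (∑ k, elt X k) + v

/-- Invariant DSS networks on sets of `n` elements of `ℝ^d` with symmetry group `H`. -/
def IsDSSNetwork {n d : ℕ} (σ : ℝ → ℝ) (H : Subgroup (Equiv.Perm (Fin d)))
    (N : (Fin n × Fin d → ℝ) → ℝ) : Prop :=
  IsPooledNet σ (fun _ _ => IsDSSLayer H) (fun _ _ => IsDSSInvariantLayer H) N

/-- The exceptional set: some two coordinates of `∑_i x_i ∈ ℝ^d` coincide. -/
def exceptionalSet (n d : ℕ) : Set (Fin n × Fin d → ℝ) :=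
  {X | ∃ j k : Fin d, j ≠ k ∧ ∑ i, X (i, j) = ∑ i, X (i, k)}

/-! Consider the uniform limits on `K` of layered DSS networks with one output channel. They form an
algebra under entrywise operations (`netLimitAlgebra`). Sums require equal depths, obtained by
inserting shallow near-identities (`exists_shallow_near_id`), which exist because `σ` is continuous
and not constant. Products come from squares, which MLPs approximate. The algebra is stable under
summing over rows or over entries of a row, and it contains every continuous `H`-invariant function
of the column sum.

By Stone–Weierstrass on a quotient of `K` (`isNetLimit_of_separated`), it suffices that the members
whose entries all agree separate the `G`-orbits (`exists_permAct_eq_of_dssAlgebra`). If they do not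
separate `X` from `X'`, the invariants of the column sums give `h ∈ H` with `s' = h · s`. As `K`
avoids the exceptional set, the coordinates of `s` are distinct, so Lagrange polynomials in the
column sums single out column `k` of `X` and column `h k` of `X'`. Every row thus becomes an ordered
vector of features in the algebra, and sums over rows of polynomials in these features determine the
multiset of rows, hence the row permutation.

A network whose entries all approximate `f` is finally averaged, with near-identities absorbing the
two activations around the pooling layer (`exists_isDSSNetwork_near`). -/

/-! ### Approximating the identity by shallow networks -/

/-- Left Riemann sums of a continuous function over the windows `[y, y + t]` converge uniformly
for `y` in a bounded interval. -/
theorem exists_riemann_sum_near {σ : ℝ → ℝ} (hσ : Continuous σ) (R : ℝ) {t ε : ℝ} (ht : 0 < t)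
    (hε : 0 < ε) :
    ∃ (N : ℕ) (τ : ℝ), ∀ y : ℝ, |y| ≤ R →
      |(∫ x in y..(y + t), σ x) - ∑ k ∈ Finset.range N, τ * σ (y + k * τ)| ≤ ε := by
  have huc : UniformContinuousOn σ (Set.Icc (-R) (R + t)) :=
    isCompact_Icc.uniformContinuousOn_of_continuous hσ.continuousOn
  rw [Metric.uniformContinuousOn_iff] at huc
  obtain ⟨δ, hδ, huc⟩ := huc (ε / t) (by positivity)
  obtain ⟨N, hN⟩ := exists_nat_gt (t / δ)
  have hN0 : (0 : ℝ) < N := lt_trans (by positivity) hN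
  have hτδ : t / N < δ := by
    rw [div_lt_iff₀ hδ] at hN
    rw [div_lt_iff₀ hN0]
    linarith
  have hNτ : (N : ℝ) * (t / N) = t := by field_simp
  have hτ0 : 0 < t / N := by positivity
  refine ⟨N, t / N, fun y hy => ?_⟩
  set τ := t / N with hτ
  obtain ⟨hy1, hy2⟩ := abs_le.mp hy
  have hint : ∀ a b : ℝ, IntervalIntegrable σ MeasureTheory.volume a b :=
    fun a b => hσ.intervalIntegrable a b
  have hsum := intervalIntegral.sum_integral_adjacent_intervals (μ := MeasureTheory.volume)
    (f := σ) (a := fun k : ℕ => y + k * τ) (n := N) (fun k _ => hint _ _)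
  simp only [Nat.cast_zero, zero_mul, add_zero, hNτ] at hsum
  rw [← hsum, ← Finset.sum_sub_distrib]
  refine (Finset.abs_sum_le_sum_abs _ _).trans ?_
  have hterm : ∀ k ∈ Finset.range N,
      |(∫ x in (y + k * τ)..(y + (k + 1 : ℕ) * τ), σ x) - τ * σ (y + k * τ)| ≤ ε / t * τ := by
    intro k hk
    have hkN : (k : ℝ) + 1 ≤ N := by exact_mod_cast Finset.mem_range.mp hk
    have hkt : ((k : ℝ) + 1) * τ ≤ t := by
      rw [← hNτ]
      exact mul_le_mul_of_nonneg_right hkN hτ0.le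
    have hk0 : 0 ≤ (k : ℝ) * τ := by positivity
    have heq : (∫ x in (y + k * τ)..(y + (k + 1 : ℕ) * τ), σ x) - τ * σ (y + k * τ) =
        ∫ x in (y + k * τ)..(y + (k + 1 : ℕ) * τ), (σ x - σ (y + k * τ)) := by
      rw [intervalIntegral.integral_sub (hint _ _) intervalIntegrable_const]
      simp only [intervalIntegral.integral_const, smul_eq_mul]
      push_cast
      ring
    rw [heq, ← Real.norm_eq_abs]
    have hlen : |y + (k + 1 : ℕ) * τ - (y + k * τ)| = τ := by
      push_cast
      rw [show y + ((k : ℝ) + 1) * τ - (y + k * τ) = τ by ring, abs_of_pos hτ0]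
    conv_rhs => rw [← hlen]
    refine intervalIntegral.norm_integral_le_of_norm_le_const fun x hx => ?_
    rw [Set.uIoc_of_le (by push_cast; nlinarith)] at hx
    push_cast at hx
    obtain ⟨hx1, hx2⟩ := hx
    have := huc x ⟨by linarith, by nlinarith⟩ (y + k * τ) ⟨by linarith, by nlinarith⟩
      (by rw [Real.dist_eq, abs_of_pos (by linarith)]; nlinarith)
    rw [Real.dist_eq] at this
    exact this.le
  refine (Finset.sum_le_sum hterm).trans (le_of_eq ?_)
  rw [Finset.sum_const, Finset.card_range, nsmul_eq_mul,
    show (N : ℝ) * (ε / t * τ) = ε / t * (N * τ) by ring, hNτ]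
  field_simp

/-- The identity is a uniform limit, on bounded intervals, of shallow networks whose activation is
continuous and not constant. -/
theorem exists_shallow_near_id {σ : ℝ → ℝ} (hσ : Continuous σ) (hne : ∃ p q, σ p ≠ σ q)
    (R : ℝ) {ε : ℝ} (hε : 0 < ε) :
    ∃ (M : ℕ) (c a w : ℝ) (b : ℕ → ℝ), ∀ x : ℝ, |x| ≤ R →
      |(∑ k ∈ Finset.range M, c * σ (a * x + b k) + w) - x| < ε := by
  obtain ⟨p, q, hpq, hD⟩ : ∃ p q, p < q ∧ σ q - σ p ≠ 0 := by
    obtain ⟨p, q, h⟩ := hne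
    rcases lt_trichotomy p q with h' | h' | h'
    · exact ⟨p, q, h', sub_ne_zero.mpr h.symm⟩
    · exact absurd (congrArg σ h') h
    · exact ⟨q, p, h', sub_ne_zero.mpr h⟩
  set t := q - p with htdef
  have ht : 0 < t := sub_pos.mpr hpq
  set D := σ q - σ p with hDdef
  -- `σ` need not be differentiable, but its window integral is, with derivative `D ≠ 0` at `p`.
  -- Hence `(S (p + a * x) - S p) / (a * D)` is close to `x` for small `a`, and Riemann sums turn
  -- `S` into a network.
  set S : ℝ → ℝ := fun y => ∫ x in y..(y + t), σ x with hS
  have hSeq : S = fun y => (∫ x in (0 : ℝ)..(y + t), σ x) - ∫ x in (0 : ℝ)..y, σ x := by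
    funext y
    rw [hS]
    exact (intervalIntegral.integral_interval_sub_left (hσ.intervalIntegrable _ _)
      (hσ.intervalIntegrable _ _)).symm
  have hderiv : HasDerivAt S D p := by
    rw [hSeq]
    have h1 : HasDerivAt (fun u => ∫ x in (0 : ℝ)..u, σ x) (σ q) (p + t) := by
      have := (hσ.integral_hasStrictDerivAt 0 (p + t)).hasDerivAt
      rwa [show σ (p + t) = σ q by rw [htdef]; ring_nf] at this
    have h2 := (hσ.integral_hasStrictDerivAt 0 p).hasDerivAt
    exact (h1.comp_add_const p t).sub h2
  set R' := |R| + 1 with hR'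
  have hR'0 : 0 < R' := by positivity
  have hDpos : 0 < |D| := abs_pos.mpr hD
  have hlo := (hasDerivAt_iff_isLittleO_nhds_zero.mp hderiv).def
    (show 0 < ε * |D| / (4 * R') by positivity)
  rw [Metric.eventually_nhds_iff] at hlo
  obtain ⟨η, hη, hlo⟩ := hlo
  -- This scale keeps `|a * x| ≤ η / 2` inside the range of the linear approximation.
  set a := η / (2 * R') with ha
  have ha0 : 0 < a := by positivity
  obtain ⟨N, τ, hN⟩ := exists_riemann_sum_near hσ (|p| + η) ht
    (show 0 < ε * (a * |D|) / 4 by positivity)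
  refine ⟨N, τ / (a * D), a, -S p / (a * D), fun k => p + k * τ, fun x hx => ?_⟩
  have hxR : |x| ≤ R' := hx.trans ((le_abs_self R).trans (by linarith))
  have hax : |a * x| ≤ η / 2 := by
    rw [abs_mul, abs_of_pos ha0]
    calc a * |x| ≤ a * R' := by gcongr
      _ = η / 2 := by rw [ha]; field_simp
  have h1 := hlo (y := a * x) (by rw [dist_zero_right, Real.norm_eq_abs]; linarith)
  have h2 := hN (p + a * x) ((abs_add_le _ _).trans (by linarith))
  rw [Real.norm_eq_abs, Real.norm_eq_abs, smul_eq_mul] at h1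
  have h3 : |S (p + a * x) - S p - a * x * D| ≤ ε * (a * |D|) / 4 := by
    refine h1.trans ?_
    rw [abs_mul, abs_of_pos ha0]
    calc ε * |D| / (4 * R') * (a * |x|) ≤ ε * |D| / (4 * R') * (a * R') := by gcongr
      _ = _ := by field_simp
  have haD : 0 < a * |D| := by positivity
  have key : (∑ k ∈ Finset.range N, τ / (a * D) * σ (a * x + (p + k * τ)) + -S p / (a * D)) - x =
      ((S (p + a * x) - S p - a * x * D) -
        (S (p + a * x) - ∑ k ∈ Finset.range N, τ * σ (p + a * x + k * τ))) / (a * D) := by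
    have : ∑ k ∈ Finset.range N, τ / (a * D) * σ (a * x + (p + k * τ)) =
        (∑ k ∈ Finset.range N, τ * σ (p + a * x + k * τ)) / (a * D) := by
      rw [Finset.sum_div]
      refine Finset.sum_congr rfl fun k _ => ?_
      rw [show a * x + (p + k * τ) = p + a * x + k * τ by ring]
      ring
    rw [this]
    field_simp
    ring
  rw [key, abs_div, abs_mul a D, abs_of_pos ha0, div_lt_iff₀ haD]
  refine (abs_sub _ _).trans_lt ?_
  have : 0 < ε * (a * |D|) := by positivity
  linarith

/-- The networks of `exists_shallow_near_id` in terms of affine maps. -/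
theorem exists_affine_act_affine_near_id {σ : ℝ → ℝ} (hσ : Continuous σ)
    (hne : ∃ p q, σ p ≠ σ q) (R : ℝ) {ε : ℝ} (hε : 0 < ε) :
    ∃ (M : ℕ) (B : (Fin 1 → ℝ) →ₗ[ℝ] (Fin M → ℝ)) (v : Fin M → ℝ)
      (A : (Fin M → ℝ) →ₗ[ℝ] (Fin 1 → ℝ)) (w : Fin 1 → ℝ),
      ∀ x : Fin 1 → ℝ, |x 0| ≤ R → |(A (act σ (B x + v)) + w) 0 - x 0| < ε := by
  obtain ⟨M, c, a, w, b, h⟩ := exists_shallow_near_id hσ hne R hε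
  refine ⟨M, a • LinearMap.funLeft ℝ ℝ (fun _ => 0), fun k => b k,
    LinearMap.pi fun _ => c • ∑ k, LinearMap.proj k, fun _ => w, fun x hx => ?_⟩
  have := h (x 0) hx
  rw [Finset.sum_range, ← Finset.mul_sum] at this
  simpa [act, LinearMap.funLeft_apply, LinearMap.sum_apply] using this

/-- Every multilayer perceptron with a constant activation is affine. -/
theorem IsMLP.exists_affine_of_const {σ : ℝ → ℝ} (h : ∀ p q, σ p = σ q) {a b : ℕ}
    {N : (Fin a → ℝ) → (Fin b → ℝ)} (hN : IsMLP σ N) :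
    ∃ (A : (Fin a → ℝ) →ₗ[ℝ] (Fin b → ℝ)) (v : Fin b → ℝ), ∀ x, N x = A x + v := by
  induction hN with
  | affine A v => exact ⟨A, v, fun _ => rfl⟩
  | comp hN A v _ =>
    refine ⟨0, A (fun _ => σ 0) + v, fun x => ?_⟩
    simp only [LinearMap.zero_apply, zero_add]
    congr 2
    funext k
    exact h _ _

/-- With a constant activation all MLPs are affine, so their second difference at `-1, 0, 1`
vanishes; that of `x ^ 2` is `2`, too large for an error of `1 / 4`. -/
theorem MLPUniversal.exists_ne {σ : ℝ → ℝ} (hMLP : MLPUniversal σ) : ∃ p q, σ p ≠ σ q := by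
  by_contra! h
  obtain ⟨N, hN, happ⟩ := hMLP 1 (Set.Icc (fun _ => -1) (fun _ => 1)) isCompact_Icc
    (fun x => x 0 ^ 2) (by fun_prop) (1 / 4) (by norm_num)
  obtain ⟨A, v, hA⟩ := hN.exists_affine_of_const h
  have mem : ∀ t : ℝ, -1 ≤ t → t ≤ 1 →
      (fun _ => t : Fin 1 → ℝ) ∈ Set.Icc (fun _ => (-1 : ℝ)) (fun _ => (1 : ℝ)) :=
    fun t h1 h2 => ⟨fun _ => h1, fun _ => h2⟩
  have h1 := happ _ (mem 1 (by norm_num) le_rfl)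
  have h2 := happ _ (mem (-1) le_rfl (by norm_num))
  have h3 := happ _ (mem 0 (by norm_num) (by norm_num))
  have hneg : A (fun _ => -1) = - A (fun _ => 1) := by
    rw [← map_neg]
    rfl
  have hzero : A (fun _ => 0) = 0 := A.map_zero
  rw [hA] at h1 h2 h3
  rw [hneg] at h2
  rw [hzero] at h3
  simp only [Pi.add_apply, Pi.neg_apply, Pi.zero_apply] at h1 h2 h3
  rw [abs_lt] at h1 h2 h3
  linarith [h1.1, h2.1, h3.2]

/-! ### Layer classes and operations on layered networks -/

/-- The closure properties of a class of layers `ℝ^{ℓ × a} → ℝ^{ℓ × b}` that make the networks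
built from it closed under the pointwise operations on functions. -/
structure IsLayerClass {ι : Type}
    (layer : ∀ a b : ℕ, ((ι → Fin a → ℝ) → (ι → Fin b → ℝ)) → Prop) : Prop where
  entrywise : ∀ {a b : ℕ} (A : (Fin a → ℝ) →ₗ[ℝ] (Fin b → ℝ)) (v : Fin b → ℝ),
    layer a b fun X e => A (X e) + v
  comp : ∀ {a b c : ℕ} {L : (ι → Fin a → ℝ) → (ι → Fin b → ℝ)}
    {L' : (ι → Fin b → ℝ) → (ι → Fin c → ℝ)}, layer a b L → layer b c L' →
      layer a c fun X => L' (L X)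
  add : ∀ {a b : ℕ} {L L' : (ι → Fin a → ℝ) → (ι → Fin b → ℝ)}, layer a b L → layer a b L' →
    layer a b fun X => L X + L' X
  continuous : ∀ {a b : ℕ} {L : (ι → Fin a → ℝ) → (ι → Fin b → ℝ)}, layer a b L → Continuous L

/-- Layered networks with exactly `k` activations. -/
inductive IsLayeredNetOfDepth {ι : Type} (σ : ℝ → ℝ)
    (layer : ∀ a b : ℕ, ((ι → Fin a → ℝ) → (ι → Fin b → ℝ)) → Prop) :
    ℕ → ∀ {a b : ℕ}, ((ι → Fin a → ℝ) → (ι → Fin b → ℝ)) → Prop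
  | single {a b : ℕ} {L : (ι → Fin a → ℝ) → (ι → Fin b → ℝ)} (hL : layer a b L) :
      IsLayeredNetOfDepth σ layer 0 L
  | comp {k a b c : ℕ} {F : (ι → Fin a → ℝ) → (ι → Fin b → ℝ)}
      {L : (ι → Fin b → ℝ) → (ι → Fin c → ℝ)} (hF : IsLayeredNetOfDepth σ layer k F)
      (hL : layer b c L) : IsLayeredNetOfDepth σ layer (k + 1) (fun x => L (fun i => act σ (F x i)))

theorem continuous_act {c : ℕ} {σ : ℝ → ℝ} (hσ : Continuous σ) :
    Continuous (act σ : (Fin c → ℝ) → (Fin c → ℝ)) :=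
  continuous_pi fun k => hσ.comp (continuous_apply k)

theorem act_append {a b : ℕ} (σ : ℝ → ℝ) (u : Fin a → ℝ) (v : Fin b → ℝ) :
    act σ (Fin.append u v) = Fin.append (act σ u) (act σ v) := by
  funext i
  refine Fin.addCases (fun i => ?_) (fun i => ?_) i <;> simp [act]

/-- Inclusion of the first block of channels. -/
def appendZero (a b : ℕ) : (Fin a → ℝ) →ₗ[ℝ] (Fin (a + b) → ℝ) where
  toFun u := Fin.append u 0
  map_add' u v := by
    funext i
    refine Fin.addCases (fun i => ?_) (fun i => ?_) i <;> simp
  map_smul' c u := by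
    funext i
    refine Fin.addCases (fun i => ?_) (fun i => ?_) i <;> simp

/-- Inclusion of the last block of channels. -/
def zeroAppend (a b : ℕ) : (Fin b → ℝ) →ₗ[ℝ] (Fin (a + b) → ℝ) where
  toFun u := Fin.append 0 u
  map_add' u v := by
    funext i
    refine Fin.addCases (fun i => ?_) (fun i => ?_) i <;> simp
  map_smul' c u := by
    funext i
    refine Fin.addCases (fun i => ?_) (fun i => ?_) i <;> simp

/-- The one-channel input of a network. -/
def oneChannel {ι : Type} (X : ι → ℝ) : ι → Fin 1 → ℝ := fun j _ => X j

theorem continuous_oneChannel {ι : Type} :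
    Continuous (oneChannel : (ι → ℝ) → ι → Fin 1 → ℝ) :=
  continuous_pi fun j => continuous_pi fun _ => continuous_apply j

section

variable {ι : Type} {σ : ℝ → ℝ}
  {layer : ∀ a b : ℕ, ((ι → Fin a → ℝ) → (ι → Fin b → ℝ)) → Prop}

theorem IsLayerClass.append (hl : IsLayerClass layer) {a b b' : ℕ}
    {L : (ι → Fin a → ℝ) → (ι → Fin b → ℝ)} {L' : (ι → Fin a → ℝ) → (ι → Fin b' → ℝ)}
    (hL : layer a b L) (hL' : layer a b' L') :
    layer a (b + b') fun X e => Fin.append (L X e) (L' X e) := by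
  have h := hl.add (hl.comp hL (hl.entrywise (appendZero b b') 0))
    (hl.comp hL' (hl.entrywise (zeroAppend b b') 0))
  convert h using 1
  funext X e i
  refine Fin.addCases (fun i => ?_) (fun i => ?_) i <;> simp [appendZero, zeroAppend]

theorem IsLayerClass.parallel (hl : IsLayerClass layer) {a a' b b' : ℕ}
    {L : (ι → Fin a → ℝ) → (ι → Fin b → ℝ)} {L' : (ι → Fin a' → ℝ) → (ι → Fin b' → ℝ)}
    (hL : layer a b L) (hL' : layer a' b' L') :
    layer (a + a') (b + b') fun X e =>
      Fin.append (L (fun e i => X e (Fin.castAdd a' i)) e)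
        (L' (fun e i => X e (Fin.natAdd a i)) e) := by
  have h := hl.append
    (hl.comp (hl.entrywise (LinearMap.funLeft ℝ ℝ (Fin.castAdd a' : Fin a → Fin (a + a'))) 0) hL)
    (hl.comp (hl.entrywise (LinearMap.funLeft ℝ ℝ (Fin.natAdd a : Fin a' → Fin (a + a'))) 0) hL')
  simp only [add_zero] at h
  exact h

theorem IsLayeredNet.exists_depth {a b : ℕ} {F : (ι → Fin a → ℝ) → (ι → Fin b → ℝ)}
    (hF : IsLayeredNet σ layer F) : ∃ k, IsLayeredNetOfDepth σ layer k F := by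
  induction hF with
  | single hL => exact ⟨0, .single hL⟩
  | comp _ hL ih =>
    obtain ⟨k, hk⟩ := ih
    exact ⟨k + 1, .comp hk hL⟩

theorem IsLayeredNetOfDepth.isLayeredNet {k a b : ℕ} {F : (ι → Fin a → ℝ) → (ι → Fin b → ℝ)}
    (hF : IsLayeredNetOfDepth σ layer k F) : IsLayeredNet σ layer F := by
  induction hF with
  | single hL => exact .single hL
  | comp _ hL ih => exact .comp ih hL

/-- No activation separates the last layer from `L`, so the two merge into one layer. -/
theorem IsLayeredNetOfDepth.layer_comp (hl : IsLayerClass layer) {k a b c : ℕ}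
    {F : (ι → Fin a → ℝ) → (ι → Fin b → ℝ)} {L : (ι → Fin b → ℝ) → (ι → Fin c → ℝ)}
    (hF : IsLayeredNetOfDepth σ layer k F) (hL : layer b c L) :
    IsLayeredNetOfDepth σ layer k fun X => L (F X) := by
  cases hF with
  | single hL' => exact .single (hl.comp hL' hL)
  | comp hF hL' => exact .comp hF (hl.comp hL' hL)

theorem IsLayeredNet.layer_comp (hl : IsLayerClass layer) {a b c : ℕ}
    {F : (ι → Fin a → ℝ) → (ι → Fin b → ℝ)} {L : (ι → Fin b → ℝ) → (ι → Fin c → ℝ)}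
    (hF : IsLayeredNet σ layer F) (hL : layer b c L) :
    IsLayeredNet σ layer fun X => L (F X) := by
  obtain ⟨k, hk⟩ := hF.exists_depth
  exact (hk.layer_comp hl hL).isLayeredNet

theorem IsLayeredNet.mlp_comp (hl : IsLayerClass layer) {a b c : ℕ}
    {F : (ι → Fin a → ℝ) → (ι → Fin b → ℝ)} {m : (Fin b → ℝ) → (Fin c → ℝ)}
    (hF : IsLayeredNet σ layer F) (hm : IsMLP σ m) :
    IsLayeredNet σ layer fun X e => m (F X e) := by
  induction hm with
  | affine A v => exact hF.layer_comp hl (hl.entrywise A v)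
  | comp _ A v ih => exact .comp ih (hl.entrywise A v)

theorem IsLayeredNet.mlp_act_comp (hl : IsLayerClass layer) {a b c : ℕ}
    {F : (ι → Fin a → ℝ) → (ι → Fin b → ℝ)} {m : (Fin b → ℝ) → (Fin c → ℝ)}
    (hF : IsLayeredNet σ layer F) (hm : IsMLP σ m) :
    IsLayeredNet σ layer fun X e => m (act σ (F X e)) := by
  induction hm with
  | affine A v => exact .comp hF (hl.entrywise A v)
  | comp _ A v ih => exact .comp ih (hl.entrywise A v)

theorem IsLayeredNet.continuous (hσ : Continuous σ) (hl : IsLayerClass layer) {a b : ℕ}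
    {F : (ι → Fin a → ℝ) → (ι → Fin b → ℝ)} (hF : IsLayeredNet σ layer F) : Continuous F := by
  induction hF with
  | single hL => exact hl.continuous hL
  | comp _ hL ih =>
    exact (hl.continuous hL).comp
      (continuous_pi fun i => (continuous_act hσ).comp ((continuous_apply i).comp ih))

/-- The two networks run side by side on separate channels; equal depth makes their activations line
up. -/
theorem IsLayeredNetOfDepth.append (hl : IsLayerClass layer) {k a b b' : ℕ}
    {F : (ι → Fin a → ℝ) → (ι → Fin b → ℝ)} {F' : (ι → Fin a → ℝ) → (ι → Fin b' → ℝ)}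
    (hF : IsLayeredNetOfDepth σ layer k F) (hF' : IsLayeredNetOfDepth σ layer k F') :
    IsLayeredNetOfDepth σ layer k fun X e => Fin.append (F X e) (F' X e) := by
  induction hF generalizing b' with
  | single hL =>
    cases hF' with
    | single hL' => exact .single (hl.append hL hL')
  | comp hG hL ih =>
    cases hF' with
    | comp hG' hL' =>
      have := IsLayeredNetOfDepth.comp (ih hG') (hl.parallel hL hL')
      simpa only [act_append, Fin.append_left, Fin.append_right] using this

theorem IsLayeredNetOfDepth.add (hl : IsLayerClass layer) {k a b : ℕ}
    {F F' : (ι → Fin a → ℝ) → (ι → Fin b → ℝ)}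
    (hF : IsLayeredNetOfDepth σ layer k F) (hF' : IsLayeredNetOfDepth σ layer k F') :
    IsLayeredNetOfDepth σ layer k fun X => F X + F' X := by
  have := (hF.append hl hF').layer_comp hl (hl.entrywise
    (LinearMap.funLeft ℝ ℝ (Fin.castAdd b : Fin b → Fin (b + b)) +
      LinearMap.funLeft ℝ ℝ (Fin.natAdd b : Fin b → Fin (b + b))) 0)
  convert this using 1
  funext X e i
  change _ = Fin.append (F X e) (F' X e) (Fin.castAdd b i) +
    Fin.append (F X e) (F' X e) (Fin.natAdd b i) + 0
  rw [Fin.append_left, Fin.append_right, add_zero]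
  rfl

/-! ### The algebra of uniform limits of networks -/

/-- `F` is a uniform limit on `K` of layered networks with one output channel. -/
def IsNetLimit (σ : ℝ → ℝ) (layer : ∀ a b : ℕ, ((ι → Fin a → ℝ) → (ι → Fin b → ℝ)) → Prop)
    (K : Set (ι → ℝ)) (F : K → ι → ℝ) : Prop :=
  ∀ ε : ℝ, 0 < ε → ∃ N : (ι → Fin 1 → ℝ) → (ι → Fin 1 → ℝ),
    IsLayeredNet σ layer N ∧ ∀ (X : K) e, |N (oneChannel X) e 0 - F X e| < ε

theorem IsNetLimit.of_net {K : Set (ι → ℝ)}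
    {N : (ι → Fin 1 → ℝ) → (ι → Fin 1 → ℝ)} (hN : IsLayeredNet σ layer N) :
    IsNetLimit σ layer K fun X e => N (oneChannel X) e 0 :=
  fun ε hε => ⟨N, hN, fun X e => by simpa using hε⟩

theorem IsNetLimit.continuous {K : Set (ι → ℝ)} (hσ : Continuous σ)
    (hl : IsLayerClass layer) {F : K → ι → ℝ}
    (hF : IsNetLimit σ layer K F) : Continuous F := by
  refine continuous_pi fun e => continuous_of_uniform_approx_of_continuous fun u hu => ?_
  obtain ⟨ε, hε, hu⟩ := Metric.mem_uniformity_dist.mp hu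
  obtain ⟨N, hN, h⟩ := hF ε hε
  refine ⟨fun X => N (oneChannel X) e 0, ?_, fun X => hu ?_⟩
  · have : Continuous fun X : K => N (oneChannel X) :=
      (hN.continuous hσ hl).comp (continuous_oneChannel.comp continuous_subtype_val)
    exact (continuous_apply 0).comp ((continuous_apply e).comp this)
  · rw [dist_comm, Real.dist_eq]
    exact h X e

end

section

variable {ι : Type} [Fintype ι] {σ : ℝ → ℝ}
  {layer : ∀ a b : ℕ, ((ι → Fin a → ℝ) → (ι → Fin b → ℝ)) → Prop}

/-- The values of a one-channel network on a compact set are bounded. -/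
theorem IsLayeredNet.exists_bound (hσ : Continuous σ) (hl : IsLayerClass layer)
    {K : Set (ι → ℝ)} (hK : IsCompact K) {F : (ι → Fin 1 → ℝ) → (ι → Fin 1 → ℝ)}
    (hF : IsLayeredNet σ layer F) : ∃ R, ∀ X ∈ K, ∀ e, |F (oneChannel X) e 0| ≤ R := by
  obtain ⟨R, hR⟩ := hK.exists_bound_of_continuousOn
    (f := fun X => F (oneChannel X)) ((hF.continuous hσ hl).comp continuous_oneChannel).continuousOn
  exact ⟨R, fun X hX e =>
    (norm_le_pi_norm (F (oneChannel X) e) 0).trans ((norm_le_pi_norm _ e).trans (hR X hX))⟩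

/-- Each extra activation is the middle of an entrywise near-identity, valid on the bounded range of
the network built so far. -/
theorem IsLayeredNetOfDepth.exists_near_add_depth (hσ : Continuous σ) (hne : ∃ p q, σ p ≠ σ q)
    (hl : IsLayerClass layer) {K : Set (ι → ℝ)} (hK : IsCompact K) {k : ℕ}
    {F : (ι → Fin 1 → ℝ) → (ι → Fin 1 → ℝ)} (hF : IsLayeredNetOfDepth σ layer k F) (l : ℕ) :
    ∀ {ε : ℝ}, 0 < ε → ∃ F' : (ι → Fin 1 → ℝ) → (ι → Fin 1 → ℝ),
      IsLayeredNetOfDepth σ layer (k + l) F' ∧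
        ∀ X ∈ K, ∀ e, |F' (oneChannel X) e 0 - F (oneChannel X) e 0| < ε := by
  induction l with
  | zero => exact fun {ε} hε => ⟨F, hF, fun X _ e => by simpa using hε⟩
  | succ l ih =>
    intro ε hε
    obtain ⟨F', hF', h'⟩ := ih (half_pos hε)
    obtain ⟨R, hR⟩ := hF'.isLayeredNet.exists_bound hσ hl hK
    obtain ⟨M, B, v, A, w, hid⟩ := exists_affine_act_affine_near_id hσ hne R (half_pos hε)
    refine ⟨_, .comp (hF'.layer_comp hl (hl.entrywise B v)) (hl.entrywise A w), fun X hX e => ?_⟩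
    have h1 := hid (F' (oneChannel X) e) (hR X hX e)
    have h2 := h' X hX e
    have := abs_sub_le ((A (act σ (B (F' (oneChannel X) e) + v)) + w) 0)
      (F' (oneChannel X) e 0) (F (oneChannel X) e 0)
    linarith

variable {K : Set (ι → ℝ)}

theorem IsNetLimit.exists_bound (hσ : Continuous σ) (hl : IsLayerClass layer) (hK : IsCompact K)
    {F : K → ι → ℝ} (hF : IsNetLimit σ layer K F) : ∃ R, ∀ X e, |F X e| ≤ R := by
  have : CompactSpace K := isCompact_iff_compactSpace.mp hK
  obtain ⟨R, hR⟩ := isCompact_univ.exists_bound_of_continuousOn (hF.continuous hσ hl).continuousOn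
  exact ⟨R, fun X e => (norm_le_pi_norm (F X) e).trans (hR X (Set.mem_univ _))⟩

theorem IsNetLimit.add (hσ : Continuous σ) (hne : ∃ p q, σ p ≠ σ q) (hl : IsLayerClass layer)
    (hK : IsCompact K) {F F' : K → ι → ℝ} (hF : IsNetLimit σ layer K F)
    (hF' : IsNetLimit σ layer K F') : IsNetLimit σ layer K (F + F') := by
  intro ε hε
  obtain ⟨N, hN, h⟩ := hF (ε / 4) (by positivity)
  obtain ⟨N', hN', h'⟩ := hF' (ε / 4) (by positivity)
  obtain ⟨k, hk⟩ := hN.exists_depth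
  obtain ⟨k', hk'⟩ := hN'.exists_depth
  obtain ⟨P, hP, hP2⟩ := hk.exists_near_add_depth hσ hne hl hK k' (ε := ε / 4) (by positivity)
  obtain ⟨P', hP', hP2'⟩ := hk'.exists_near_add_depth hσ hne hl hK k (ε := ε / 4) (by positivity)
  rw [add_comm k' k] at hP'
  refine ⟨_, (hP.add hl hP').isLayeredNet, fun X e => ?_⟩
  have h1 := abs_lt.mp (h X e)
  have h2 := abs_lt.mp (h' X e)
  have h3 := abs_lt.mp (hP2 X X.2 e)
  have h4 := abs_lt.mp (hP2' X X.2 e)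
  simp only [Pi.add_apply]
  rw [abs_lt]
  constructor <;> linarith [h1.1, h1.2, h2.1, h2.2, h3.1, h3.2, h4.1, h4.2]

theorem IsNetLimit.layer_comp (hl : IsLayerClass layer) {F : K → ι → ℝ}
    (hF : IsNetLimit σ layer K F) {L : (ι → Fin 1 → ℝ) → (ι → Fin 1 → ℝ)} (hL : layer 1 1 L)
    (huc : UniformContinuous L) : IsNetLimit σ layer K fun X e => L (oneChannel (F X)) e 0 := by
  intro ε hε
  obtain ⟨δ, hδ, huc⟩ := Metric.uniformContinuous_iff.mp huc ε hε
  obtain ⟨N, hN, h⟩ := hF δ hδ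
  refine ⟨_, hN.layer_comp hl hL, fun X e => ?_⟩
  have : dist (N (oneChannel X)) (oneChannel (F X)) < δ := by
    refine (dist_pi_lt_iff hδ).mpr fun e => (dist_pi_lt_iff hδ).mpr fun i => ?_
    rw [Subsingleton.elim i 0, Real.dist_eq]
    exact h X e
  have h2 := (dist_pi_lt_iff hε).mp ((dist_pi_lt_iff hε).mp (huc this) e) 0
  rwa [Real.dist_eq] at h2

theorem IsNetLimit.const_smul (hl : IsLayerClass layer) {F : K → ι → ℝ}
    (hF : IsNetLimit σ layer K F) (c : ℝ) : IsNetLimit σ layer K (c • F) := by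
  have := hF.layer_comp hl (hl.entrywise (c • LinearMap.id) 0)
    (uniformContinuous_pi.mpr fun e => uniformContinuous_pi.mpr fun i => by
      have : UniformContinuous fun X : ι → Fin 1 → ℝ => X e i :=
        (Pi.uniformContinuous_proj _ i).comp (Pi.uniformContinuous_proj _ e)
      simpa [Pi.smul_def] using this.const_smul c)
  convert this using 1
  funext X e
  simp [oneChannel]

theorem IsNetLimit.sq (hσ : Continuous σ) (hMLP : MLPUniversal σ) (hl : IsLayerClass layer)
    (hK : IsCompact K) {F : K → ι → ℝ} (hF : IsNetLimit σ layer K F) :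
    IsNetLimit σ layer K (F * F) := by
  intro ε hε
  obtain ⟨R₀, hR₀⟩ := hF.exists_bound hσ hl hK
  set R := |R₀| + 1 with hRdef
  have hR0 : 0 < R := by positivity
  have hR : ∀ X e, |F X e| ≤ R := fun X e =>
    (hR₀ X e).trans ((le_abs_self R₀).trans (by linarith))
  -- Chosen for `|y² - F²| = |y - F| * |y + F|`, where the second factor is at most `2 * R + 1`.
  set δ := min 1 (ε / (2 * (2 * R + 1))) with hδ
  have hδ0 : 0 < δ := by positivity
  obtain ⟨N, hN, h⟩ := hF δ hδ0
  obtain ⟨m, hm, hm2⟩ := hMLP 1 (Set.Icc (fun _ => -(R + 1)) (fun _ => R + 1)) isCompact_Icc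
    (fun x => x 0 * x 0) (by fun_prop) (ε / 2) (half_pos hε)
  refine ⟨_, hN.mlp_comp hl hm, fun X e => ?_⟩
  set y := N (oneChannel X) e with hy
  have h1 : |y 0 - F X e| < δ := h X e
  have h1a : |y 0 - F X e| < 1 := h1.trans_le (min_le_left _ _)
  have h1b : |y 0 - F X e| < ε / (2 * (2 * R + 1)) := h1.trans_le (min_le_right _ _)
  have hFR := abs_le.mp (hR X e)
  have h1c := abs_lt.mp h1a
  have h2 := hm2 y ⟨fun i => by rw [Subsingleton.elim i 0]; linarith [h1c.1, hFR.1],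
    fun i => by rw [Subsingleton.elim i 0]; linarith [h1c.2, hFR.2]⟩
  have h3 : |y 0 + F X e| ≤ 2 * R + 1 :=
    abs_le.mpr ⟨by linarith [h1c.1, hFR.1], by linarith [h1c.2, hFR.2]⟩
  have h4 : |y 0 * y 0 - F X e * F X e| ≤ ε / 2 := by
    rw [show y 0 * y 0 - F X e * F X e = (y 0 - F X e) * (y 0 + F X e) by ring, abs_mul]
    calc |y 0 - F X e| * |y 0 + F X e| ≤ ε / (2 * (2 * R + 1)) * (2 * R + 1) := by gcongr
      _ = ε / 2 := by field_simp
  have := abs_sub_le (m y 0) (y 0 * y 0) (F X e * F X e)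
  simp only [Pi.mul_apply]
  linarith

/-- Polarization: `4 F F' = (F + F')² - (F - F')²`. -/
theorem IsNetLimit.mul (hσ : Continuous σ) (hMLP : MLPUniversal σ) (hl : IsLayerClass layer)
    (hK : IsCompact K) {F F' : K → ι → ℝ} (hF : IsNetLimit σ layer K F)
    (hF' : IsNetLimit σ layer K F') : IsNetLimit σ layer K (F * F') := by
  have hne := hMLP.exists_ne
  have h1 := (hF.add hσ hne hl hK hF').sq hσ hMLP hl hK
  have h2 := (hF.add hσ hne hl hK (hF'.const_smul hl (-1))).sq hσ hMLP hl hK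
  have h := (h1.add hσ hne hl hK (h2.const_smul hl (-1))).const_smul hl (1 / 4)
  convert h using 1
  funext X e
  simp only [Pi.mul_apply, Pi.add_apply, Pi.smul_apply, smul_eq_mul]
  ring

/-- The algebra of uniform limits on `K` of layered networks with one output channel. -/
def netLimitAlgebra (hσ : Continuous σ) (hMLP : MLPUniversal σ) (hl : IsLayerClass layer)
    (hK : IsCompact K) : Subalgebra ℝ (K → ι → ℝ) where
  carrier := {F | IsNetLimit σ layer K F}
  mul_mem' := IsNetLimit.mul hσ hMLP hl hK
  add_mem' := IsNetLimit.add hσ hMLP.exists_ne hl hK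
  algebraMap_mem' c := by
    have := IsNetLimit.of_net (K := K) (σ := σ) (layer := layer)
      (.single (hl.entrywise (0 : (Fin 1 → ℝ) →ₗ[ℝ] (Fin 1 → ℝ)) (fun _ => c)))
    refine (congrArg (IsNetLimit σ layer K) ?_).mp this
    funext X e
    simp [Pi.algebraMap_apply]

end

/-! ### DSS layers and `H`-invariant networks of the column sum -/

section

variable {n d : ℕ} {H : Subgroup (Equiv.Perm (Fin d))} {σ : ℝ → ℝ}

/-- DSS layers in terms of the elements and of the full sum of the elements. -/
theorem isDSSLayer_iff {a b : ℕ} {L : (Fin n × Fin d → Fin a → ℝ) → (Fin n × Fin d → Fin b → ℝ)} :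
    IsDSSLayer H L ↔ ∃ (A B : (Fin d → Fin a → ℝ) →ₗ[ℝ] (Fin d → Fin b → ℝ))
      (v : Fin d → Fin b → ℝ),
      (∀ h ∈ H, ∀ x, A (permAct h x) = permAct h (A x)) ∧
      (∀ h ∈ H, ∀ x, B (permAct h x) = permAct h (B x)) ∧
      (∀ h ∈ H, permAct h v = v) ∧
      ∀ X i, elt (L X) i = A (elt X i) + B (∑ k, elt X k) + v := by
  constructor
  · rintro ⟨L₁, L₂, v, h₁, h₂, hv, hL⟩
    refine ⟨L₁ - L₂, L₂, v, fun h hh x => ?_, h₂, hv, fun X i => ?_⟩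
    · rw [LinearMap.sub_apply, LinearMap.sub_apply, h₁ h hh, h₂ h hh]
      rfl
    · rw [hL, Finset.sum_erase_eq_sub (Finset.mem_univ i), map_sub, LinearMap.sub_apply]
      abel
  · rintro ⟨A, B, v, hA, hB, hv, hL⟩
    refine ⟨A + B, B, v, fun h hh x => ?_, hB, hv, fun X i => ?_⟩
    · rw [LinearMap.add_apply, LinearMap.add_apply, hA h hh, hB h hh]
      rfl
    · rw [hL, Finset.sum_erase_eq_sub (Finset.mem_univ i), map_sub, LinearMap.add_apply]
      abel

theorem isLayerClass_isDSSLayer :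
    IsLayerClass fun a b => IsDSSLayer (n := n) H (a := a) (b := b) where
  entrywise A v := isDSSLayer_iff.mpr
    ⟨LinearMap.pi fun j => A ∘ₗ LinearMap.proj j, 0, fun _ => v,
      fun _ _ _ => rfl, fun _ _ _ => rfl, fun _ _ => rfl,
      fun X i => by
        funext j
        simp [elt]⟩
  comp := by
    intro a b c L L' hL hL'
    obtain ⟨A, B, v, hA, hB, hv, hL⟩ := isDSSLayer_iff.mp hL
    obtain ⟨A', B', v', hA', hB', hv', hL'⟩ := isDSSLayer_iff.mp hL'
    -- With `s` the sum of the elements, the outputs of `L` sum to `A s + n • B s + n • v`; `B'` is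
    -- applied to this.
    refine isDSSLayer_iff.mpr ⟨A' ∘ₗ A, A' ∘ₗ B + B' ∘ₗ A + n • (B' ∘ₗ B), A' v + n • B' v + v',
      fun h hh x => ?_, fun h hh x => ?_, fun h hh => ?_, fun X i => ?_⟩
    · simp only [LinearMap.comp_apply, hA h hh, hA' h hh]
    · simp only [LinearMap.add_apply, LinearMap.smul_apply, LinearMap.comp_apply, hA h hh,
        hA' h hh, hB h hh, hB' h hh]
      rfl
    · have h1 := hA' h hh v
      have h2 := hB' h hh v
      rw [hv h hh] at h1 h2
      change permAct h (A' v) + n • permAct h (B' v) + permAct h v' = _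
      rw [← h1, ← h2, hv' h hh]
    · rw [hL']
      simp only [hL, Finset.sum_add_distrib, map_add, ← map_sum, Finset.sum_const,
        Finset.card_univ, Fintype.card_fin, LinearMap.add_apply, LinearMap.smul_apply,
        LinearMap.comp_apply, map_nsmul]
      abel
  add := by
    intro a b L L' hL hL'
    obtain ⟨A, B, v, hA, hB, hv, hL⟩ := isDSSLayer_iff.mp hL
    obtain ⟨A', B', v', hA', hB', hv', hL'⟩ := isDSSLayer_iff.mp hL'
    refine isDSSLayer_iff.mpr ⟨A + A', B + B', v + v',
      fun h hh x => ?_, fun h hh x => ?_, fun h hh => ?_, fun X i => ?_⟩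
    · rw [LinearMap.add_apply, LinearMap.add_apply, hA h hh, hA' h hh]
      rfl
    · rw [LinearMap.add_apply, LinearMap.add_apply, hB h hh, hB' h hh]
      rfl
    · change permAct h v + permAct h v' = _
      rw [hv h hh, hv' h hh]
    · change elt (L X) i + elt (L' X) i = _
      rw [hL, hL', LinearMap.add_apply, LinearMap.add_apply]
      abel
  continuous := by
    intro a b L hL
    obtain ⟨A, B, v, hA, hB, hv, hL⟩ := isDSSLayer_iff.mp hL
    refine continuous_pi fun p => ?_
    have : (fun X => L X p) =
        fun X => (A (elt X p.1) + B (∑ k, elt X k) + v) p.2 := by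
      funext X
      rw [← hL]
      rfl
    rw [this]
    have helt : ∀ i, Continuous fun X : Fin n × Fin d → Fin a → ℝ => elt X i :=
      fun i => continuous_pi fun j => continuous_apply (i, j)
    have hA := A.continuous_of_finiteDimensional.comp (helt p.1)
    have hB := B.continuous_of_finiteDimensional.comp
      (continuous_finsetSum Finset.univ fun k _ => helt k)
    exact (continuous_apply p.2).comp ((hA.add hB).add continuous_const)

theorem elt_permAct_prodCongr {α : Type} (q : Equiv.Perm (Fin n)) (h : Equiv.Perm (Fin d))
    (X : Fin n × Fin d → α) (i : Fin n) :
    elt (permAct (Equiv.prodCongr q h) X) i = permAct h (elt X (q⁻¹ i)) := rfl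

theorem sum_elt_permAct_prodCongr {a : ℕ} (q : Equiv.Perm (Fin n)) (h : Equiv.Perm (Fin d))
    (X : Fin n × Fin d → Fin a → ℝ) :
    ∑ k, elt (permAct (Equiv.prodCongr q h) X) k = permAct h (∑ k, elt X k) := by
  simp only [elt_permAct_prodCongr]
  rw [Equiv.sum_comp q⁻¹ fun k => permAct h (elt X k)]
  funext j
  simp [permAct, Finset.sum_apply]

/-- DSS layers are equivariant. -/
theorem IsDSSLayer.isEquivariantLayer {a b : ℕ}
    {L : (Fin n × Fin d → Fin a → ℝ) → (Fin n × Fin d → Fin b → ℝ)} (hL : IsDSSLayer H L) :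
    IsEquivariantLayer (setSymmetryGroup n H) L := by
  obtain ⟨A, B, v, hA, hB, hv, hL⟩ := isDSSLayer_iff.mp hL
  have eltAdd : ∀ (X Y : Fin n × Fin d → Fin a → ℝ) i, elt (X + Y) i = elt X i + elt Y i :=
    fun _ _ _ => rfl
  have eltSmul : ∀ (c : ℝ) (X : Fin n × Fin d → Fin a → ℝ) i, elt (c • X) i = c • elt X i :=
    fun _ _ _ => rfl
  refine ⟨{
    toFun X p := (A (elt X p.1) + B (∑ k, elt X k)) p.2
    map_add' X Y := by
      funext p
      simp only [eltAdd, Finset.sum_add_distrib, map_add, Pi.add_apply]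
      abel
    map_smul' c X := by
      funext p
      simp only [eltSmul, ← Finset.smul_sum, map_smul, Pi.add_apply, Pi.smul_apply, smul_add,
        RingHom.id_apply] }, fun p => v p.2, ?_, ?_, fun X => ?_⟩
  · rintro _ ⟨q, h, hh, rfl⟩ X
    funext p
    simp only [LinearMap.coe_mk, AddHom.coe_mk, sum_elt_permAct_prodCongr q h X]
    simp only [elt_permAct_prodCongr, hA h hh, hB h hh]
    rfl
  · rintro _ ⟨q, h, hh, rfl⟩
    funext p
    exact congrFun (hv h hh) p.2
  · funext p
    exact congrFun (hL X p.1) p.2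

/-- Invariant DSS layers are invariant. -/
theorem IsDSSInvariantLayer.isInvariantLayer {a b : ℕ}
    {L : (Fin n × Fin d → Fin a → ℝ) → (Fin b → ℝ)} (hL : IsDSSInvariantLayer H L) :
    IsInvariantLayer (setSymmetryGroup n H) L := by
  obtain ⟨A, v, hA, hL⟩ := hL
  have eltAdd : ∀ (X Y : Fin n × Fin d → Fin a → ℝ) i, elt (X + Y) i = elt X i + elt Y i :=
    fun _ _ _ => rfl
  have eltSmul : ∀ (c : ℝ) (X : Fin n × Fin d → Fin a → ℝ) i, elt (c • X) i = c • elt X i :=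
    fun _ _ _ => rfl
  refine ⟨{
    toFun X := A (∑ k, elt X k)
    map_add' X Y := by simp only [eltAdd, Finset.sum_add_distrib, map_add]
    map_smul' c X := by
      simp only [eltSmul, ← Finset.smul_sum, map_smul, RingHom.id_apply] }, v, ?_, hL⟩
  rintro _ ⟨q, h, hh, rfl⟩ X
  simp only [LinearMap.coe_mk, AddHom.coe_mk, sum_elt_permAct_prodCongr, hA h hh]

theorem IsLayeredNet.mono {ι : Type}
    {layer layer' : ∀ a b : ℕ, ((ι → Fin a → ℝ) → (ι → Fin b → ℝ)) → Prop}
    (h : ∀ a b L, layer a b L → layer' a b L) {a b : ℕ}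
    {F : (ι → Fin a → ℝ) → (ι → Fin b → ℝ)} (hF : IsLayeredNet σ layer F) :
    IsLayeredNet σ layer' F := by
  induction hF with
  | single hL => exact .single (h _ _ _ hL)
  | comp _ hL ih => exact .comp ih (h _ _ _ hL)

/-- DSS networks are invariant networks. -/
theorem IsDSSNetwork.isInvariantNetwork {N : (Fin n × Fin d → ℝ) → ℝ} (hN : IsDSSNetwork σ H N) :
    IsInvariantNetwork σ (setSymmetryGroup n H) N := by
  obtain ⟨c₁, c₂, F, h, m, hF, hh, hm, hN⟩ := hN
  exact ⟨c₁, c₂, F, h, m, hF.mono fun _ _ _ => IsDSSLayer.isEquivariantLayer,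
    hh.isInvariantLayer, hm, hN⟩

/-- An `H`-equivariant network applied to the sum of the elements, with the result given to every
element, is a DSS network. -/
theorem IsLayeredNet.sum_elt {a b : ℕ} {F : (Fin d → Fin a → ℝ) → (Fin d → Fin b → ℝ)}
    (hF : IsLayeredNet σ (fun _ _ => IsEquivariantLayer H) F) :
    IsLayeredNet σ (fun _ _ => IsDSSLayer H)
      fun (X : Fin n × Fin d → Fin a → ℝ) p => F (∑ k, elt X k) p.2 := by
  induction hF with
  | single hL =>
    obtain ⟨A, v, hA, hv, hL⟩ := hL
    -- The first layer reads only the sum. Afterwards all elements are equal, so later layers can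
    -- act on each element alone.
    refine .single (isDSSLayer_iff.mpr ⟨0, A, v, fun _ _ _ => rfl, hA, hv, fun X i => ?_⟩)
    funext j
    simp [elt, hL]
  | @comp b c F L hF hL ih =>
    obtain ⟨A, v, hA, hv, hL⟩ := hL
    have : IsDSSLayer H fun (X : Fin n × Fin d → Fin b → ℝ) p => L (elt X p.1) p.2 :=
      isDSSLayer_iff.mpr ⟨A, 0, v, hA, fun _ _ _ => rfl, hv, fun X i => by
        funext j
        change L (elt X i) j = _
        simp [hL]⟩
    exact .comp ih this

theorem isDSSLayer_sum_rows : IsDSSLayer H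
    fun (X : Fin n × Fin d → Fin 1 → ℝ) (p : Fin n × Fin d) => ∑ i, X (i, p.2) :=
  isDSSLayer_iff.mpr ⟨0, LinearMap.id, 0, fun _ _ _ => rfl, fun _ _ _ => rfl, fun _ _ => rfl,
    fun X i => by
      funext j
      simp [elt, Finset.sum_apply]⟩

theorem isDSSLayer_sum_entries : IsDSSLayer H
    fun (X : Fin n × Fin d → Fin 1 → ℝ) (p : Fin n × Fin d) => ∑ j, X (p.1, j) := by
  refine isDSSLayer_iff.mpr ⟨LinearMap.pi fun _ => ∑ j, LinearMap.proj j, 0, 0, fun h _ x => ?_,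
    fun _ _ _ => rfl, fun _ _ => rfl, fun X i => ?_⟩
  · funext j
    simp only [LinearMap.pi_apply, LinearMap.sum_apply, LinearMap.proj_apply, permAct]
    exact Equiv.sum_comp h⁻¹ x
  · funext j
    simp [elt, LinearMap.sum_apply]

/-- An `H`-invariant network applied to the sum of the elements, with the result given to every
entry, is a layered DSS network. -/
theorem IsInvariantNetwork.exists_layeredNet {N : (Fin d → ℝ) → ℝ}
    (hN : IsInvariantNetwork σ H N) :
    ∃ P : (Fin n × Fin d → Fin 1 → ℝ) → (Fin n × Fin d → Fin 1 → ℝ),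
      IsLayeredNet σ (fun _ _ => IsDSSLayer H) P ∧
        ∀ X e, P (oneChannel X) e 0 = N fun j => ∑ i, X (i, j) := by
  obtain ⟨c₁, c₂, F, h, m, hF, ⟨A, v, hA, hh⟩, hm, hN⟩ := hN
  -- An invariant layer becomes equivariant by copying its value to every coordinate; the final MLP
  -- then acts entrywise.
  have hpool : IsDSSLayer H
      fun (X : Fin n × Fin d → Fin c₁ → ℝ) (p : Fin n × Fin d) => h (elt X p.1) := by
    refine isDSSLayer_iff.mpr ⟨LinearMap.pi fun _ => A, 0, fun _ => v, fun g hg x => ?_,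
      fun _ _ _ => rfl, fun _ _ => rfl, fun X i => ?_⟩
    · funext j
      simp [permAct, ← hA g hg x]
    · funext j
      change h (elt X i) = _
      simp [hh]
  refine ⟨_, (IsLayeredNet.comp (hF.sum_elt (n := n)) hpool).mlp_act_comp isLayerClass_isDSSLayer hm,
    fun X e => ?_⟩
  rw [hN]
  have : ∑ k, elt (oneChannel X) k = fun j _ => ∑ i, X (i, j) := by
    funext j c
    simp [elt, oneChannel, Finset.sum_apply]
  simp only [this]
  rfl

end

/-! ### Separation of the orbits by the DSS algebra -/

section

variable {n d : ℕ} {H : Subgroup (Equiv.Perm (Fin d))} {σ : ℝ → ℝ}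
  {K : Set (Fin n × Fin d → ℝ)}

theorem IsDSSLayer.uniformContinuous {a b : ℕ}
    {L : (Fin n × Fin d → Fin a → ℝ) → (Fin n × Fin d → Fin b → ℝ)} (hL : IsDSSLayer H L) :
    UniformContinuous L := by
  obtain ⟨A, v, -, -, hA⟩ := hL.isEquivariantLayer
  rw [show L = fun X => A X + v from funext hA]
  exact (LinearMap.toContinuousLinearMap A).uniformContinuous.add uniformContinuous_const

/-- The sum of the elements. -/
def columnSum (X : Fin n × Fin d → ℝ) : Fin d → ℝ := fun j => ∑ i, X (i, j)

theorem continuous_columnSum : Continuous (columnSum (n := n) (d := d)) :=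
  continuous_pi fun j => continuous_finsetSum _ fun i _ => continuous_apply (i, j)

theorem columnSum_permAct (h : Equiv.Perm (Fin d)) (X : Fin n × Fin d → ℝ) :
    columnSum (permAct (Equiv.prodCongr 1 h) X) = permAct h (columnSum X) := rfl

theorem IsStable.permAct_mem {ι : Type} {Γ : Subgroup (Equiv.Perm ι)} {K : Set (ι → ℝ)}
    (hK : IsStable Γ K) {g : Equiv.Perm ι} (hg : g ∈ Γ) {X : ι → ℝ} (hX : X ∈ K) :
    permAct g X ∈ K := by
  rw [hK]
  exact Set.mem_biUnion hg (Set.mem_image_of_mem _ hX)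

theorem isStable_image_columnSum (hstable : IsStable (setSymmetryGroup n H) K) :
    IsStable H (columnSum '' K) := by
  refine Set.Subset.antisymm (fun s hs => Set.mem_biUnion H.one_mem ⟨s, hs, rfl⟩) ?_
  refine Set.iUnion₂_subset fun h hh => ?_
  rintro _ ⟨_, ⟨X, hX, rfl⟩, rfl⟩
  exact ⟨_, hstable.permAct_mem ⟨1, h, hh, rfl⟩ hX, columnSum_permAct h X⟩

variable (hσ : Continuous σ) (hMLP : MLPUniversal σ) (hK : IsCompact K)

/-- The algebra of uniform limits on `K` of layered DSS networks with one output channel. -/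
abbrev dssAlgebra (H : Subgroup (Equiv.Perm (Fin d))) :
    Subalgebra ℝ (K → Fin n × Fin d → ℝ) :=
  netLimitAlgebra hσ hMLP (isLayerClass_isDSSLayer (H := H)) hK

theorem input_mem_dssAlgebra : (fun X e => X.1 e) ∈ dssAlgebra hσ hMLP hK H := by
  have := IsNetLimit.of_net (K := K) (σ := σ) (.single
    ((isLayerClass_isDSSLayer (n := n) (H := H)).entrywise (LinearMap.id : (Fin 1 → ℝ) →ₗ[ℝ] _) 0))
  simp only [LinearMap.id_apply, add_zero] at this
  exact this

variable {hσ hMLP hK}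

theorem sum_rows_mem_dssAlgebra {F : K → Fin n × Fin d → ℝ} (hF : F ∈ dssAlgebra hσ hMLP hK H) :
    (fun X p => ∑ i, F X (i, p.2)) ∈ dssAlgebra hσ hMLP hK H := by
  have := IsNetLimit.layer_comp isLayerClass_isDSSLayer hF isDSSLayer_sum_rows
    (isDSSLayer_sum_rows (H := H)).uniformContinuous
  simp only [Finset.sum_apply] at this
  exact this

theorem sum_entries_mem_dssAlgebra {F : K → Fin n × Fin d → ℝ}
    (hF : F ∈ dssAlgebra hσ hMLP hK H) :
    (fun X p => ∑ j, F X (p.1, j)) ∈ dssAlgebra hσ hMLP hK H := by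
  have := IsNetLimit.layer_comp isLayerClass_isDSSLayer hF isDSSLayer_sum_entries
    (isDSSLayer_sum_entries (H := H)).uniformContinuous
  simp only [Finset.sum_apply] at this
  exact this

theorem invariant_columnSum_mem_dssAlgebra (hH : InvariantNetworksUniversal σ H)
    (hstable : IsStable (setSymmetryGroup n H) K) {φ : (Fin d → ℝ) → ℝ} (hφ : Continuous φ)
    (hinv : ∀ h ∈ H, ∀ x, φ (permAct h x) = φ x) :
    (fun X _ => φ (columnSum X.1)) ∈ dssAlgebra hσ hMLP hK H := by
  intro ε hε
  obtain ⟨N, hN, happ⟩ := hH _ (hK.image continuous_columnSum) (isStable_image_columnSum hstable)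
    φ hφ.continuousOn (fun h hh x _ => hinv h hh x) ε hε
  obtain ⟨P, hP, hPN⟩ := hN.exists_layeredNet (n := n)
  refine ⟨P, hP, fun X e => ?_⟩
  rw [hPN]
  exact happ _ ⟨X.1, X.2, rfl⟩

/-- Vectors that are not separated by the continuous invariant functions of a permutation group
lie in the same orbit. -/
theorem exists_permAct_eq_of_invariants_eq (H : Subgroup (Equiv.Perm (Fin d))) {s s' : Fin d → ℝ}
    (h : ∀ φ : (Fin d → ℝ) → ℝ, Continuous φ → (∀ g ∈ H, ∀ x, φ (permAct g x) = φ x) →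
      φ s = φ s') : ∃ g ∈ H, s' = permAct g s := by
  classical
  -- The product over `H` of the squared distances from `g · x` to `s` is invariant and vanishes
  -- exactly on the orbit of `s`.
  set φ : (Fin d → ℝ) → ℝ := fun x => ∏ g : H, ∑ j, (permAct g.1 x j - s j) ^ 2 with hφ
  have hcont : Continuous φ := by
    refine continuous_finsetProd _ fun g _ => continuous_finsetSum _ fun j _ => ?_
    exact ((continuous_apply (g.1⁻¹ j)).sub continuous_const).pow 2
  have hinv : ∀ g ∈ H, ∀ x, φ (permAct g x) = φ x := by
    intro g hg x
    rw [hφ]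
    refine Fintype.prod_equiv (Equiv.mulRight ⟨g, hg⟩) _ _ fun g' => ?_
    simp [permAct]
  have h0 : φ s = 0 := Finset.prod_eq_zero (Finset.mem_univ (1 : H)) (by simp [permAct])
  have h1 := h φ hcont hinv
  rw [h0, eq_comm, hφ, Finset.prod_eq_zero_iff] at h1
  obtain ⟨g, -, hg⟩ := h1
  rw [Finset.sum_eq_zero_iff_of_nonneg fun _ _ => sq_nonneg _] at hg
  refine ⟨g.1⁻¹, H.inv_mem g.2, funext fun j => ?_⟩
  have := hg (g.1 j) (Finset.mem_univ _)
  rw [sq_eq_zero_iff, sub_eq_zero] at this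
  simpa [permAct] using this

/-- Two families are equal up to a permutation if every point `v` is isolated from their other
values by a function whose sums over the two families agree. -/
theorem exists_perm_of_forall_sum_eq {α β : Type} [Fintype α] (w w' : α → β)
    (h : ∀ v : β, ∃ Q : β → ℝ, Q v ≠ 0 ∧ (∀ i, w i ≠ v → Q (w i) = 0) ∧
      (∀ i, w' i ≠ v → Q (w' i) = 0) ∧ ∑ i, Q (w i) = ∑ i, Q (w' i)) :
    ∃ q : Equiv.Perm α, ∀ i, w' i = w (q i) := by
  classical
  have hcard : ∀ v, Fintype.card {i // w' i = v} = Fintype.card {i // w i = v} := by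
    intro v
    obtain ⟨Q, hv, hw, hw', hsum⟩ := h v
    -- The sum of `Q` sees only the fibre over `v`, so equal sums give fibres of equal size, which
    -- are then matched bijectively.
    have count : ∀ u : α → β, (∀ i, u i ≠ v → Q (u i) = 0) →
        ∑ i, Q (u i) = Fintype.card {i // u i = v} * Q v := by
      intro u hu
      rw [Fintype.card_subtype, ← nsmul_eq_mul, ← Finset.sum_const, Finset.sum_filter]
      refine Finset.sum_congr rfl fun i _ => ?_
      split_ifs with hi
      · rw [hi]
      · exact hu i hi
    rw [count w hw, count w' hw'] at hsum
    exact_mod_cast (mul_right_cancel₀ hv hsum).symm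
  exact ⟨Equiv.ofFiberEquiv fun v => Fintype.equivOfCardEq (hcard v),
    fun i => (Equiv.ofFiberEquiv_map _ i).symm⟩

theorem exists_permAct_eq_of_dssAlgebra (hd : 0 < d) (hH : InvariantNetworksUniversal σ H)
    (hstable : IsStable (setSymmetryGroup n H) K) {X X' : K}
    (hX : Function.Injective (columnSum X.1))
    (hagree : ∀ g : K → ℝ, (fun Y _ => g Y) ∈ dssAlgebra hσ hMLP hK H → g X = g X') :
    ∃ g ∈ setSymmetryGroup n H, X'.1 = permAct g X.1 := by
  classical
  obtain ⟨h, hh, hs⟩ := exists_permAct_eq_of_invariants_eq H fun φ hφ hinv =>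
    hagree _ (invariant_columnSum_mem_dssAlgebra hH hstable hφ hinv)
  set s := columnSum X.1 with hsdef
  have hs' : ∀ j, columnSum X'.1 j = s (h⁻¹ j) := fun j => congrFun hs j
  have hleft : ∀ k, h⁻¹ (h k) = k := h.symm_apply_apply
  have hright : ∀ k, h (h⁻¹ k) = k := h.apply_symm_apply
  set 𝓐 := dssAlgebra hσ hMLP hK H with h𝓐
  -- The double sum has the same value at all entries, so `hagree` applies to it.
  have htotal : ∀ F ∈ 𝓐, ∑ j : Fin d, ∑ i, F X (i, j) = ∑ j : Fin d, ∑ i, F X' (i, j) :=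
    fun F hF => hagree (fun Y => ∑ j, ∑ i, F Y (i, j))
      (sum_entries_mem_dssAlgebra (sum_rows_mem_dssAlgebra hF))
  have hconst : ∀ c : ℝ, (fun _ _ => c) ∈ 𝓐 := fun c => 𝓐.algebraMap_mem c
  have hinput : (fun Y e => Y.1 e) ∈ 𝓐 := input_mem_dssAlgebra hσ hMLP hK
  have hcol : (fun Y e => columnSum Y.1 e.2) ∈ 𝓐 := sum_rows_mem_dssAlgebra hinput
  -- Lagrange basis polynomials at the nodes `s l`, which are distinct by `hX`.
  let b : Fin d → ℝ → ℝ := fun k t => ∏ l ∈ Finset.univ.erase k, (t - s l) * (s k - s l)⁻¹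
  have hb : ∀ k j, b k (s j) = if j = k then 1 else 0 := by
    intro k j
    split_ifs with hjk
    · subst hjk
      refine Finset.prod_eq_one fun l hl => mul_inv_cancel₀ (sub_ne_zero.mpr fun e => ?_)
      exact Finset.ne_of_mem_erase hl (hX e).symm
    · exact Finset.prod_eq_zero (Finset.mem_erase.mpr ⟨hjk, Finset.mem_univ j⟩) (by simp)
  let y : Fin d → K → Fin n × Fin d → ℝ :=
    fun k Y p => ∑ j, b k (columnSum Y.1 j) * Y.1 (p.1, j)
  have hy : ∀ k, y k ∈ 𝓐 := by
    intro k
    have hprod : (∏ l ∈ Finset.univ.erase k, (((fun Y e => columnSum Y.1 e.2) -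
        (fun _ _ => s l)) * (fun _ _ => (s k - s l)⁻¹) : K → Fin n × Fin d → ℝ)) ∈ 𝓐 :=
      𝓐.prod_mem fun l _ => 𝓐.mul_mem (𝓐.sub_mem hcol (hconst _)) (hconst _)
    have := sum_entries_mem_dssAlgebra (𝓐.mul_mem hprod hinput)
    convert this using 1
    funext Y p
    simp [y, b, Finset.prod_apply]
  have hyX : ∀ k i j, y k X (i, j) = X.1 (i, k) := by
    intro k i j
    simp only [y]
    rw [Finset.sum_eq_single k]
    · rw [← hsdef, hb, if_pos rfl, one_mul]
    · intro l _ hl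
      rw [← hsdef, hb, if_neg hl, zero_mul]
    · simp
  -- The column sum of `X'` at `j` is `s (h⁻¹ j)`, so the node `s k` is now met at `j = h k`.
  have hyX' : ∀ k i j, y k X' (i, j) = X'.1 (i, h k) := by
    intro k i j
    simp only [y, hs']
    rw [Finset.sum_eq_single (h k)]
    · rw [hleft, hb, if_pos rfl, one_mul]
    · intro l _ hl
      rw [hb, if_neg, zero_mul]
      rintro rfl
      simp at hl
    · simp
  let w : Fin n → Fin d → ℝ := fun i k => X.1 (i, k)
  let w' : Fin n → Fin d → ℝ := fun i k => X'.1 (i, h k)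
  obtain ⟨q, hq⟩ := exists_perm_of_forall_sum_eq w w' (by
    intro v
    -- `W` collects the rows other than `v` that occur; `Q` is a polynomial vanishing exactly on
    -- `W`.
    let W : Finset (Fin d → ℝ) := (Finset.univ.image w ∪ Finset.univ.image w').erase v
    let Q : (Fin d → ℝ) → ℝ := fun x => ∏ u ∈ W, ∑ k, (x k - u k) * (x k - u k)
    have hQ0 : ∀ u ∈ W, Q u = 0 := fun u hu => Finset.prod_eq_zero hu (by simp)
    refine ⟨Q, ?_, fun i hi => hQ0 _ ?_, fun i hi => hQ0 _ ?_, ?_⟩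
    · refine Finset.prod_ne_zero_iff.mpr fun u hu h0 => Finset.ne_of_mem_erase hu ?_
      rw [Finset.sum_eq_zero_iff_of_nonneg fun _ _ => mul_self_nonneg _] at h0
      funext k
      exact (sub_eq_zero.mp (mul_self_eq_zero.mp (h0 k (Finset.mem_univ k)))).symm
    · exact Finset.mem_erase.mpr ⟨hi, by simp⟩
    · exact Finset.mem_erase.mpr ⟨hi, by simp⟩
    · have hmem : (∏ u ∈ W, ∑ k, ((y k - fun _ _ => u k) * (y k - fun _ _ => u k))) ∈ 𝓐 :=
        𝓐.prod_mem fun u _ => 𝓐.sum_mem fun k _ =>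
          𝓐.mul_mem (𝓐.sub_mem (hy k) (hconst _)) (𝓐.sub_mem (hy k) (hconst _))
      -- The features do not depend on the column index, so the total is `d` times the sum over
      -- rows, and `d > 0` cancels.
      have hfeat := htotal _ hmem
      simp only [Finset.prod_apply, Finset.sum_apply, Pi.mul_apply, Pi.sub_apply, hyX,
        hyX', Finset.sum_const, Finset.card_univ, Fintype.card_fin, nsmul_eq_mul] at hfeat
      exact mul_left_cancel₀ (Nat.cast_ne_zero.mpr hd.ne') hfeat)
  -- The action evaluates at inverse permutations, hence `q⁻¹`.
  refine ⟨Equiv.prodCongr q⁻¹ h, ⟨q⁻¹, h, hh, rfl⟩, funext fun p => ?_⟩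
  have := congrFun (hq p.1) (h⁻¹ p.2)
  simp only [w, w', hright] at this
  exact this

end

/-! ### Pooling, Stone–Weierstrass and the conclusion -/

/-- A bound for the distance of an average to a point. -/
theorem abs_average_sub_le {α : Type} [Fintype α] [Nonempty α] {u : α → ℝ} {t r : ℝ}
    (h : ∀ p, |u p - t| ≤ r) : |(Fintype.card α : ℝ)⁻¹ * ∑ p, u p - t| ≤ r := by
  have hc : (0 : ℝ) < Fintype.card α := Nat.cast_pos.mpr Fintype.card_pos
  have : (Fintype.card α : ℝ)⁻¹ * ∑ p, u p - t = (Fintype.card α : ℝ)⁻¹ * ∑ p, (u p - t) := by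
    rw [Finset.sum_sub_distrib, Finset.sum_const, Finset.card_univ, nsmul_eq_mul]
    field_simp
  rw [this, abs_mul, abs_of_pos (inv_pos.mpr hc), inv_mul_le_iff₀ hc]
  refine (Finset.abs_sum_le_sum_abs _ _).trans ((Finset.sum_le_sum fun p _ => h p).trans ?_)
  rw [Finset.sum_const, Finset.card_univ, nsmul_eq_mul]

section

variable {n d : ℕ} {H : Subgroup (Equiv.Perm (Fin d))} {σ : ℝ → ℝ}
  {K : Set (Fin n × Fin d → ℝ)}

theorem isDSSNetwork_const (σ : ℝ → ℝ) (H : Subgroup (Equiv.Perm (Fin d))) (c : ℝ) :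
    IsDSSNetwork (n := n) σ H fun _ => c :=
  ⟨1, 1, _, fun _ => 0, _,
    .single (isLayerClass_isDSSLayer.entrywise (0 : (Fin 1 → ℝ) →ₗ[ℝ] (Fin 1 → ℝ)) 0),
    ⟨0, 0, fun _ _ _ => rfl, fun _ => by simp⟩,
    .affine (0 : (Fin 1 → ℝ) →ₗ[ℝ] (Fin 1 → ℝ)) (fun _ => c), fun _ => by simp⟩

/-- A layered DSS network whose entries all approximate `f` can be pooled. -/
theorem exists_isDSSNetwork_near (hσ : Continuous σ) (hne : ∃ p q, σ p ≠ σ q)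
    (hK : IsCompact K) [Nonempty (Fin n × Fin d)]
    {f : (Fin n × Fin d → ℝ) → ℝ} (hf : IsNetLimit σ (fun _ _ => IsDSSLayer H) K fun X _ => f X)
    {ε : ℝ} (hε : 0 < ε) :
    ∃ N : (Fin n × Fin d → ℝ) → ℝ, IsDSSNetwork σ H N ∧ ∀ X ∈ K, |N X - f X| < ε := by
  obtain ⟨P, hP, hPf⟩ := hf (ε / 2) (half_pos hε)
  obtain ⟨R, hR⟩ := hP.exists_bound hσ isLayerClass_isDSSLayer hK
  -- The same near-identity is used before and after pooling. The radius leaves room for its first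
  -- error `ε / 4`; the errors add up to `ε / 4 + ε / 4 + ε / 2`.
  obtain ⟨M, B, v, A, w, hid⟩ := exists_affine_act_affine_near_id hσ hne (R + ε / 4)
    (show 0 < ε / 4 by positivity)
  set c : ℝ := (Fintype.card (Fin n × Fin d) : ℝ)⁻¹ with hc
  have hc1 : c * Fintype.card (Fin n × Fin d) = 1 :=
    inv_mul_cancel₀ (Nat.cast_ne_zero.mpr Fintype.card_ne_zero)
  -- The pooling layer decodes by `A`, averages over all entries and encodes again by `B`. The
  -- average of the bias `w` is `w`, so the bias of the layer is `B w + v`.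
  let L₀ : (Fin d → Fin M → ℝ) →ₗ[ℝ] (Fin M → ℝ) :=
    c • ∑ j, (B ∘ₗ A) ∘ₗ LinearMap.proj j
  have hL₀ : ∀ x, L₀ x = c • ∑ j, B (A (x j)) := fun x => by
    simp [L₀, LinearMap.sum_apply]
  have hpool : IsDSSInvariantLayer (n := n) H fun X => L₀ (∑ k, elt X k) + (B w + v) := by
    refine ⟨L₀, B w + v, fun h _ x => ?_, fun X => rfl⟩
    rw [hL₀, hL₀]
    simp only [permAct]
    rw [Equiv.sum_comp h⁻¹ fun j => B (A (x j))]
  have hentry := isLayerClass_isDSSLayer (n := n) (H := H) |>.entrywise B v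
  refine ⟨_, ⟨M, M, _, _, _, hP.layer_comp isLayerClass_isDSSLayer hentry, hpool,
    .affine A w, fun _ => rfl⟩, fun X hX => ?_⟩
  let u : Fin n × Fin d → Fin 1 → ℝ := fun p => A (act σ (B (P (oneChannel X) p) + v)) + w
  have hu : ∀ p, |u p 0 - P (oneChannel X) p 0| < ε / 4 := fun p =>
    hid _ ((hR X hX p).trans (by linarith))
  have havg : L₀ (∑ k, elt (fun p => act σ (B (P (oneChannel X) p) + v)) k) + (B w + v) =
      B (c • ∑ p, u p) + v := by
    have h1 : ∑ p, u p = ∑ p, A (act σ (B (P (oneChannel X) p) + v)) +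
        Fintype.card (Fin n × Fin d) • w := by
      simp only [u, Finset.sum_add_distrib, Finset.sum_const, Finset.card_univ]
    rw [h1, smul_add, map_add, add_assoc, hL₀, map_smul, map_sum]
    congr 1
    · rw [Fintype.sum_prod_type_right]
      congr 1
      refine Finset.sum_congr rfl fun j _ => ?_
      rw [Finset.sum_apply, map_sum, map_sum]
      rfl
    · rw [← Nat.cast_smul_eq_nsmul ℝ, smul_smul, hc1, one_smul]
  have hval : (c • ∑ p, u p) 0 = c * ∑ p, u p 0 := by
    simp [Finset.sum_apply]
  have h1 : |(c • ∑ p, u p) 0 - f X| ≤ ε / 4 + ε / 2 := by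
    rw [hval]
    refine abs_average_sub_le fun p => ?_
    have := abs_sub_le (u p 0) (P (oneChannel X) p 0) (f X)
    linarith [hu p, hPf ⟨X, hX⟩ p]
  have h2 : |(c • ∑ p, u p) 0| ≤ R + ε / 4 := by
    rw [hval, ← sub_zero (c * _)]
    refine abs_average_sub_le fun p => ?_
    have := abs_sub_le (u p 0) (P (oneChannel X) p 0) 0
    rw [sub_zero (P (oneChannel X) p 0)] at this
    linarith [hu p, hR X hX p]
  have h3 := hid _ h2
  rw [← havg] at h3
  refine (abs_sub_le _ ((c • ∑ p, u p) 0) _).trans_lt ?_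
  have h4 := add_lt_add_of_lt_of_le h3 h1
  rw [show ε / 4 + (ε / 4 + ε / 2) = ε by ring] at h4
  exact h4

/-- By the Stone–Weierstrass theorem on the quotient of `K` by the points that the algebra does not
separate, a continuous function which is constant on the classes lies in the closure of the
algebra. -/
theorem isNetLimit_of_separated (hσ : Continuous σ) (hMLP : MLPUniversal σ) (hK : IsCompact K)
    [Nonempty (Fin n × Fin d)] {f : (Fin n × Fin d → ℝ) → ℝ} (hf : ContinuousOn f K)
    (hsep : ∀ X X' : K, (∀ g : K → ℝ, (fun Y _ => g Y) ∈ dssAlgebra hσ hMLP hK H → g X = g X') →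
      f X = f X') :
    IsNetLimit σ (fun _ _ => IsDSSLayer H) K fun X _ => f X := by
  have : CompactSpace K := isCompact_iff_compactSpace.mp hK
  let S : Setoid K :=
    { r := fun X X' => ∀ g : K → ℝ, (fun Y _ => g Y) ∈ dssAlgebra hσ hMLP hK H → g X = g X'
      iseqv := ⟨fun _ _ _ => rfl, fun h g hg => (h g hg).symm,
        fun h h' g hg => (h g hg).trans (h' g hg)⟩ }
  let π : C(Quotient S, ℝ) →ₐ[ℝ] (K → Fin n × Fin d → ℝ) :=
    { toFun := fun g X _ => g (Quotient.mk S X)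
      map_one' := rfl
      map_mul' := fun _ _ => rfl
      map_zero' := rfl
      map_add' := fun _ _ => rfl
      commutes' := fun _ => rfl }
  -- Functions on the quotient whose pullback, copied to every entry, lies in the DSS algebra; they
  -- separate points by the choice of `S`.
  let A : Subalgebra ℝ C(Quotient S, ℝ) := (dssAlgebra hσ hMLP hK H).comap π
  have hA : A.SeparatesPoints := by
    intro x y hxy
    induction x using Quotient.inductionOn with | _ X => ?_
    induction y using Quotient.inductionOn with | _ Y => ?_
    have hXY : ¬ S X Y := fun h => hxy (Quotient.sound h)
    obtain ⟨g, hg, hne⟩ : ∃ g : K → ℝ, (fun Y _ => g Y) ∈ dssAlgebra hσ hMLP hK H ∧ g X ≠ g Y := by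
      by_contra! h
      exact hXY h
    have hgc : Continuous g := (continuous_apply (Classical.arbitrary (Fin n × Fin d))).comp
      (IsNetLimit.continuous hσ isLayerClass_isDSSLayer hg)
    refine ⟨_, ⟨⟨Quotient.lift g fun a b h => h g hg, hgc.quotient_lift _⟩, hg, rfl⟩, hne⟩
  let φ : C(Quotient S, ℝ) :=
    ⟨Quotient.lift (fun X : K => f X) hsep,
      (continuousOn_iff_continuous_domRestrict.mp hf).quotient_lift _⟩
  intro ε hε
  obtain ⟨g, hg⟩ := ContinuousMap.exists_mem_subalgebra_near_continuousMap_of_separatesPoints A hA φ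
    (ε / 2) (half_pos hε)
  obtain ⟨N, hN, happ⟩ := g.2 (ε / 2) (half_pos hε)
  refine ⟨N, hN, fun X e => ?_⟩
  have h1 := happ X e
  have h2 : |g.1 (Quotient.mk S X) - f X| < ε / 2 :=
    ((g.1 - φ).norm_coe_le_norm (Quotient.mk S X)).trans_lt hg
  have h3 := abs_sub_le (N (oneChannel X) e 0) (g.1 (Quotient.mk S X)) (f X)
  have h4 : |N (oneChannel X) e 0 - g.1 (Quotient.mk S X)| < ε / 2 := h1
  linarith

end

theorem theorem2 (σ : ℝ → ℝ) (hσ : Continuous σ) (hMLP : MLPUniversal σ)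
    (n d : ℕ) (H : Subgroup (Equiv.Perm (Fin d)))
    (hH : InvariantNetworksUniversal σ H)
    (K : Set (Fin n × Fin d → ℝ)) (hK : IsCompact K)
    (hstable : IsStable (setSymmetryGroup n H) K)
    (hE : K ∩ exceptionalSet n d = ∅)
    (f : (Fin n × Fin d → ℝ) → ℝ) (hf : ContinuousOn f K)
    (hinv : IsInvariantOn (setSymmetryGroup n H) K f)
    (ε : ℝ) (hε : 0 < ε) :
    ∃ N : (Fin n × Fin d → ℝ) → ℝ,
      IsDSSNetwork σ H N ∧ IsInvariantNetwork σ (setSymmetryGroup n H) N ∧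
        ∀ X ∈ K, |N X - f X| < ε := by
  suffices h : ∃ N : (Fin n × Fin d → ℝ) → ℝ, IsDSSNetwork σ H N ∧ ∀ X ∈ K, |N X - f X| < ε by
    obtain ⟨N, hN, happ⟩ := h
    exact ⟨N, hN, hN.isInvariantNetwork, happ⟩
  rcases isEmpty_or_nonempty (Fin n × Fin d) with hempty | hnonempty
  -- With no entries the matrix space is a single point.
  · refine ⟨_, isDSSNetwork_const σ H (f 0), fun X _ => ?_⟩
    rw [Subsingleton.elim X 0, sub_self, abs_zero]
    exact hε
  · have hd : 0 < d := (Classical.arbitrary (Fin n × Fin d)).2.pos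
    refine exists_isDSSNetwork_near hσ hMLP.exists_ne hK
      (isNetLimit_of_separated hσ hMLP hK hf fun X X' hagree => ?_) hε
    have hX : Function.Injective (columnSum X.1) := by
      intro j k hjk
      by_contra hne
      have : X.1 ∈ K ∩ exceptionalSet n d := ⟨X.2, j, k, hne, hjk⟩
      rw [hE] at this
      exact this
    obtain ⟨g, hg, hgX⟩ := exists_permAct_eq_of_dssAlgebra hd hH hstable hX hagree
    rw [hgX, hinv g hg X.1 X.2]
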